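/- Let $R=\bigoplus_{n\in\mathbb Z}R_n$ be a $\mathbb Z$-graded (associative, unital) ring which is right artinian. For a nonzero $\mathbb Z$-graded right $R$-module $M=\bigoplus_{n\in\mathbb Z}M_n$ (so $M_iR_j\subseteq M_{i+j}$) let $$\mathrm{gr.l.}(M)=\sup\{n\mid M_n\neq 0\}-\inf\{n\mid M_n\neq 0\}+1\in\mathbb N\cup\{\infty\}$$ be its graded length, and let $$G_R=\sup\{\mathrm{gr.l.}(M)\mid M \text{ a finitely generated graded right } R\text{-module that is indecomposable as a graded module}\}.$$ Assume that $G_R<\infty$. Let $X=\bigoplus_{n\in\mathbb Z}X_n$ be a graded right $R$-module that is locally finite, i.e. each $X_n$ has finite length as a right $R_0$-module. Then $X$ is pure-projective as a right $R$-module, i.e. it is isomorphic to a direct summand of a direct sum of finitely presented right $R$-modules. -/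

import Mathlib

universe u v

namespace GradedArtinian

/-- `ℳ` is a family of subgroups of the right `R`-module `M` (a module over `Rᵐᵒᵖ`, with
`m r = MulOpposite.op r • m`) such that `M_i R_j ⊆ M_{i+j}`.  Together with
`DirectSum.Decomposition ℳ`, i.e. `M = ⨁ M_i`, this says that `M` is a graded right module over
the graded ring `R = ⨁ R_j`, `R_j = 𝒜 j`. -/
def IsRightGraded {R : Type u} [Ring R] (𝒜 : ℤ → AddSubgroup R)
    {M : Type v} [AddCommGroup M] [Module Rᵐᵒᵖ M] (ℳ : ℤ → AddSubgroup M) : Prop :=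
  ∀ ⦃i j : ℤ⦄ ⦃m : M⦄ ⦃r : R⦄, m ∈ ℳ i → r ∈ 𝒜 j → MulOpposite.op r • m ∈ ℳ (i + j)

/-- The opposite of the initial subring `R_0`, as a subring of `Rᵐᵒᵖ`.  Its left modules are the
right `R_0`-modules. -/
abbrev initialSubringOp {R : Type u} [Ring R] (𝒜 : ℤ → AddSubgroup R) [GradedRing 𝒜] :
    Subring Rᵐᵒᵖ :=
  (SetLike.GradeZero.subring 𝒜).op

/-- The homogeneous piece `M_i` of a graded right module, as a right `R_0`-submodule of `M`. -/
def homogeneousPiece {R : Type u} [Ring R] (𝒜 : ℤ → AddSubgroup R) [GradedRing 𝒜]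
    {M : Type v} [AddCommGroup M] [Module Rᵐᵒᵖ M] (ℳ : ℤ → AddSubgroup M)
    (h : IsRightGraded 𝒜 ℳ) (i : ℤ) : Submodule (initialSubringOp 𝒜) M where
  carrier := ℳ i
  add_mem' := (ℳ i).add_mem
  zero_mem' := (ℳ i).zero_mem
  smul_mem' := fun r m hm => by
    have hr : (MulOpposite.unop (r : Rᵐᵒᵖ)) ∈ 𝒜 0 := r.2
    have := h hm hr
    rwa [add_zero] at this

/-- A graded right module is locally finite if each homogeneous piece has finite length as a
right `R_0`-module. -/
def IsLocallyFinite {R : Type u} [Ring R] (𝒜 : ℤ → AddSubgroup R) [GradedRing 𝒜]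
    {M : Type v} [AddCommGroup M] [Module Rᵐᵒᵖ M] (ℳ : ℤ → AddSubgroup M)
    (h : IsRightGraded 𝒜 ℳ) : Prop :=
  ∀ i : ℤ, IsFiniteLength (initialSubringOp 𝒜) (homogeneousPiece 𝒜 ℳ h i)

/-- The graded length `sup {n | M_n ≠ 0} - inf {n | M_n ≠ 0} + 1 ∈ ℕ ∪ {∞}`, as the supremum of
the numbers `b - a + 1` over all degrees `a ≤ b` with `M_a ≠ 0` and `M_b ≠ 0`. -/
noncomputable def gradedLength {M : Type v} [AddCommGroup M] (ℳ : ℤ → AddSubgroup M) : ℕ∞ :=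
  ⨆ (a : ℤ) (b : ℤ) (_ : a ≤ b) (_ : ℳ a ≠ ⊥) (_ : ℳ b ≠ ⊥), (((b - a + 1).toNat : ℕ) : ℕ∞)

/-- A graded right module is indecomposable in the category of graded modules and degree-zero
maps: it is nonzero, and in every decomposition as an internal direct sum of two graded
(i.e. homogeneous) submodules one of the two is zero. -/
def IsGradedIndecomposable (R : Type u) [Ring R]
    {M : Type v} [AddCommGroup M] [Module Rᵐᵒᵖ M] (ℳ : ℤ → AddSubgroup M)
    [DirectSum.Decomposition ℳ] : Prop :=
  Nontrivial M ∧ ∀ N K : Submodule Rᵐᵒᵖ M, N.IsHomogeneous ℳ → K.IsHomogeneous ℳ →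
    IsCompl N K → N = ⊥ ∨ K = ⊥

/-- `G_R`: the supremum of the graded lengths of the finitely generated indecomposable graded
right `R`-modules.  Every finitely generated module is isomorphic to one in the universe of `R`. -/
noncomputable def supGradedLength {R : Type u} [Ring R] (𝒜 : ℤ → AddSubgroup R) : ℕ∞ :=
  ⨆ (M : Type u) (_ : AddCommGroup M) (_ : Module Rᵐᵒᵖ M) (ℳ : ℤ → AddSubgroup M)
    (_ : DirectSum.Decomposition ℳ) (_ : IsRightGraded 𝒜 ℳ) (_ : Module.Finite Rᵐᵒᵖ M)
    (_ : IsGradedIndecomposable R ℳ), gradedLength ℳ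

/-- An `S`-module is pure-projective if it is (isomorphic to) a direct summand of a direct sum of
finitely presented modules.  Being isomorphic to a direct summand is expressed by a split
monomorphism.  Every finitely presented module is isomorphic to one in the universe of `S`. -/
def IsPureProjective (S : Type u) [Ring S] (M : Type v) [AddCommGroup M] [Module S M] : Prop :=
  ∃ (ι : Type (max u v)) (P : ι → Type u) (_ : ∀ i, AddCommGroup (P i)) (_ : ∀ i, Module S (P i)),
    (∀ i, Module.FinitePresentation S (P i)) ∧
      ∃ (f : M →ₗ[S] DirectSum ι P) (g : DirectSum ι P →ₗ[S] M), g ∘ₗ f = LinearMap.id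

end GradedArtinian

/-! For each degree `d` there is a graded idempotent endomorphism `e d` of `X` with finitely
generated range that is the identity on `X_d` (`exists_finite_endomorphism`). Its range is the part
`A` of the submodule `Y` generated by the `X_i` with `|i - d| ≤ 2G`: `exists_splitting` writes `Y =
A ⊕ B`, where `A` collects the indecomposable summands that meet degree `d`, hence live within
distance `G` of `d`, and `B` vanishes in degree `d`. As `R` lives in degrees of absolute value at
most `G` (`abs_degree_le`), no multiplication reaches that window from outside `Y`, so `A` is a
direct summand of `X` and not only of `Y`.

Enumerate the degrees and put `c_n = (1 - e_{n-1}) ⋯ (1 - e_0)`. Every element is killed by some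
`c_n`, so `∑ e_n c_n = ∑ (c_n - c_{n+1})` is pointwise finite and equals the identity. Thus `X` is a
summand of the direct sum of the ranges of the `e_n c_n`, which are finitely presented because a
right artinian ring is right noetherian. -/

namespace GradedArtinian

open DirectSum MulOpposite

/-! ### Homogeneous components and induced gradings -/

section Component

variable {M : Type v} [AddCommGroup M] (ℳ : ℤ → AddSubgroup M) [Decomposition ℳ]

/-- The projection of `M = ⨁ M_i` onto `M_i`, as an endomorphism of `M`. -/
def component (i : ℤ) : M →+ M where
  toFun x := (decompose ℳ x i : M)
  map_zero' := by simp
  map_add' x y := by simp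

lemma component_mem (i : ℤ) (x : M) : component ℳ i x ∈ ℳ i :=
  (decompose ℳ x i).2

variable {ℳ} in
lemma component_of_mem {i : ℤ} {x : M} (hx : x ∈ ℳ i) : component ℳ i x = x :=
  decompose_of_mem_same ℳ hx

variable {ℳ} in
lemma component_of_mem_of_ne {i j : ℤ} {x : M} (hx : x ∈ ℳ i) (h : i ≠ j) :
    component ℳ j x = 0 :=
  decompose_of_mem_ne ℳ hx h

lemma exists_sum_component_eq (x : M) : ∃ s : Finset ℤ, ∑ i ∈ s, component ℳ i x = x := by
  classical
  exact ⟨_, sum_support_decompose ℳ x⟩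

lemma mem_of_component_mem {S : AddSubgroup M} {x : M} (h : ∀ i, component ℳ i x ∈ S) :
    x ∈ S := by
  obtain ⟨s, hs⟩ := exists_sum_component_eq ℳ x
  rw [← hs]
  exact S.sum_mem fun i _ => h i

lemma eq_zero_of_component_eq_zero {x : M} (h : ∀ i, component ℳ i x = 0) : x = 0 := by
  have := mem_of_component_mem ℳ (S := ⊥) (x := x) (by simpa using h)
  simpa using this

variable {M' : Type*} [AddCommGroup M'] (φ : M' →+ M)

/-- The grading induced on a group that is embedded as a homogeneous subgroup. -/
@[reducible]
noncomputable def comapDecomposition (hφ : Function.Injective φ)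
    (h : ∀ i x, component ℳ i (φ x) ∈ φ.range) :
    Decomposition (fun i => (ℳ i).comap φ) := by
  refine IsInternal.chooseDecomposition _ ⟨?_, ?_⟩
  · let ψ : (⨁ i, (ℳ i).comap φ) →+ ⨁ i, ℳ i :=
      DirectSum.map fun i => (φ.comp ((ℳ i).comap φ).subtype).codRestrict (ℳ i) fun x => x.2
    have hψ : Function.Injective ψ := by
      refine (DirectSum.map_injective _).2 fun i x y hxy => ?_
      exact Subtype.ext (hφ (congrArg Subtype.val hxy))
    have hcomp : φ.comp (DirectSum.coeAddMonoidHom fun i => (ℳ i).comap φ) =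
        (DirectSum.coeAddMonoidHom ℳ).comp ψ := by
      refine DirectSum.addHom_ext fun i y => ?_
      simp [ψ, DirectSum.map_of]
      rfl
    have hinj : Function.Injective ((DirectSum.coeAddMonoidHom ℳ).comp ψ) :=
      (Decomposition.isInternal ℳ).injective.comp hψ
    rw [← hcomp] at hinj
    exact Function.Injective.of_comp hinj
  · intro x
    choose y hy using h
    obtain ⟨s, hs⟩ := exists_sum_component_eq ℳ (φ x)
    refine ⟨∑ i ∈ s, DirectSum.of (fun i => (ℳ i).comap φ) i
      ⟨y i x, by simpa [hy] using component_mem ℳ i (φ x)⟩, hφ ?_⟩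
    simp [map_sum, hy, hs]

lemma map_component_comap [Decomposition (fun i => (ℳ i).comap φ)] (i : ℤ) (x : M') :
    φ (component (fun i => (ℳ i).comap φ) i x) = component ℳ i (φ x) := by
  obtain ⟨s, hs⟩ := exists_sum_component_eq (fun i => (ℳ i).comap φ) x
  conv_rhs => rw [← hs]
  simp only [map_sum]
  have key : ∀ j, component ℳ i (φ (component (fun i => (ℳ i).comap φ) j x)) =
      φ (component (fun i => (ℳ i).comap φ) i (component (fun i => (ℳ i).comap φ) j x)) := by
    intro j
    have hm := component_mem (fun i => (ℳ i).comap φ) j x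
    obtain rfl | hij := eq_or_ne j i
    · rw [component_of_mem (ℳ := ℳ) hm,
        component_of_mem (ℳ := fun i => (ℳ i).comap φ) hm]
    · rw [component_of_mem_of_ne (ℳ := ℳ) hm hij,
        component_of_mem_of_ne (ℳ := fun i => (ℳ i).comap φ) hm hij, map_zero]
  simp only [key, ← map_sum, hs]

end Component

/-- Needed because `supGradedLength` and `IsPureProjective` only quantify over modules in the
universe of the ring, while `X` may live in another one. -/
lemma exists_linearEquiv_of_finite (S : Type u) [Ring S] (M : Type v) [AddCommGroup M]
    [Module S M] [Module.Finite S M] :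
    ∃ (P : Type u) (_ : AddCommGroup P) (_ : Module S P), Nonempty (P ≃ₗ[S] M) := by
  obtain ⟨n, f, hf⟩ := Module.Finite.exists_fin' S M
  exact ⟨(Fin n → S) ⧸ LinearMap.ker f, inferInstance, inferInstance,
    ⟨f.quotKerEquivOfSurjective hf⟩⟩

/-! ### Homogeneous submodules -/

variable {R : Type u} [Ring R] {𝒜 : ℤ → AddSubgroup R}
variable {X : Type v} [AddCommGroup X] [Module Rᵐᵒᵖ X] {𝒳 : ℤ → AddSubgroup X}

lemma smul_mem_of_component_smul_mem [GradedRing 𝒜] [Decomposition 𝒳] {S : AddSubgroup X}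
    {r : R} {x : X} (h : ∀ i j, op (component 𝒜 j r) • component 𝒳 i x ∈ S) : op r • x ∈ S := by
  obtain ⟨s, hs⟩ := exists_sum_component_eq 𝒳 x
  obtain ⟨t, ht⟩ := exists_sum_component_eq 𝒜 r
  rw [← hs, ← ht, Finset.smul_sum]
  refine S.sum_mem fun i _ => ?_
  rw [Finset.op_sum, Finset.sum_smul]
  exact S.sum_mem fun j _ => h i j

/-- The graded submodule `⨁ (X_i ∩ T_i)`. -/
def ofComponents [GradedRing 𝒜] [Decomposition 𝒳] (h𝒳 : IsRightGraded 𝒜 𝒳)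
    (T : ℤ → AddSubgroup X)
    (hT : ∀ ⦃i j : ℤ⦄ ⦃m : X⦄ ⦃r : R⦄, m ∈ 𝒳 i → m ∈ T i → r ∈ 𝒜 j → op r • m ∈ T (i + j)) :
    Submodule Rᵐᵒᵖ X where
  carrier := {x | ∀ i, component 𝒳 i x ∈ T i}
  zero_mem' i := by simp
  add_mem' hx hy i := by simpa using (T i).add_mem (hx i) (hy i)
  smul_mem' := by
    intro r x hx k
    change op r.unop • x ∈ (T k).comap (component 𝒳 k)
    refine smul_mem_of_component_smul_mem (𝒜 := 𝒜) (𝒳 := 𝒳) fun i j => ?_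
    have hmem := h𝒳 (component_mem 𝒳 i x) (component_mem 𝒜 j r.unop)
    rw [AddSubgroup.mem_comap]
    obtain rfl | hk := eq_or_ne (i + j) k
    · rw [component_of_mem hmem]
      exact hT (component_mem 𝒳 i x) (hx i) (component_mem 𝒜 j r.unop)
    · rw [component_of_mem_of_ne hmem hk]
      exact zero_mem _

lemma mem_ofComponents_of_mem [GradedRing 𝒜] [Decomposition 𝒳] {h𝒳 : IsRightGraded 𝒜 𝒳}
    {T : ℤ → AddSubgroup X} {hT} {i : ℤ} {x : X} (hx : x ∈ 𝒳 i) (hxT : x ∈ T i) :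
    x ∈ ofComponents h𝒳 T hT := by
  intro k
  obtain rfl | hk := eq_or_ne i k
  · rwa [component_of_mem hx]
  · rw [component_of_mem_of_ne hx hk]
    exact zero_mem _

lemma isHomogeneous_ofComponents [GradedRing 𝒜] [Decomposition 𝒳] (h𝒳 : IsRightGraded 𝒜 𝒳)
    (T : ℤ → AddSubgroup X) (hT) : (ofComponents h𝒳 T hT).IsHomogeneous 𝒳 :=
  fun i x hx => mem_ofComponents_of_mem (component_mem 𝒳 i x) (hx i)

lemma isHomogeneous_span [GradedRing 𝒜] [Decomposition 𝒳] (h𝒳 : IsRightGraded 𝒜 𝒳)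
    {s : Set X} (hs : ∀ x ∈ s, ∃ i, x ∈ 𝒳 i) :
    (Submodule.span Rᵐᵒᵖ s).IsHomogeneous 𝒳 := by
  -- The elements all of whose components lie in the span form a submodule; it contains the
  -- generators, hence the span.
  let C := ofComponents h𝒳 (fun _ => (Submodule.span Rᵐᵒᵖ s).toAddSubgroup)
    (fun _ _ _ r _ hm _ => (Submodule.span Rᵐᵒᵖ s).smul_mem (op r) hm)
  have : Submodule.span Rᵐᵒᵖ s ≤ C := by
    refine Submodule.span_le.2 fun x hx => ?_
    obtain ⟨i, hi⟩ := hs x hx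
    exact mem_ofComponents_of_mem hi (Submodule.subset_span hx)
  exact fun i x hx => this hx i

lemma isHomogeneous_sup [Decomposition 𝒳] {N K : Submodule Rᵐᵒᵖ X}
    (hN : N.IsHomogeneous 𝒳) (hK : K.IsHomogeneous 𝒳) : (N ⊔ K).IsHomogeneous 𝒳 := by
  intro i x hx
  obtain ⟨y, hy, z, hz, rfl⟩ := Submodule.mem_sup.1 hx
  change component 𝒳 i (y + z) ∈ _
  rw [map_add]
  exact add_mem (Submodule.mem_sup_left (hN i hy)) (Submodule.mem_sup_right (hK i hz))

/-! ### Splitting finitely generated graded modules -/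

/-- In a finitely generated indecomposable graded submodule, any two degrees of nonzero elements
differ by at most `G_R`. -/
lemma sub_le_of_indecomposable {G : ℕ} (hG : supGradedLength 𝒜 ≤ G) [Decomposition 𝒳]
    (h𝒳 : IsRightGraded 𝒜 𝒳) {N : Submodule Rᵐᵒᵖ X} (hN : N.IsHomogeneous 𝒳) (hfg : N.FG)
    (hind : ∀ K L : Submodule Rᵐᵒᵖ X, K.IsHomogeneous 𝒳 → L.IsHomogeneous 𝒳 → K ⊔ L = N →
      Disjoint K L → K = ⊥ ∨ L = ⊥)
    {a b : ℤ} {x y : X} (hx : x ∈ N) (hxa : x ∈ 𝒳 a) (hx0 : x ≠ 0) (hy : y ∈ N) (hyb : y ∈ 𝒳 b)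
    (hy0 : y ≠ 0) : b - a ≤ G := by
  obtain hab | hab := lt_or_ge b a
  · omega
  have : Module.Finite Rᵐᵒᵖ N := Module.Finite.iff_fg.2 hfg
  obtain ⟨P, _, _, ⟨e⟩⟩ := exists_linearEquiv_of_finite Rᵐᵒᵖ N
  let φ : P →ₗ[Rᵐᵒᵖ] X := N.subtype ∘ₗ e.toLinearMap
  have hφ : Function.Injective φ := N.injective_subtype.comp e.injective
  have hrange : LinearMap.range φ = N := by simp [φ, LinearMap.range_comp]
  have hmem : ∀ z, φ z ∈ N := fun z => (e z).2
  have hex : ∀ z ∈ N, ∃ w, φ w = z := fun z hz => ⟨e.symm ⟨z, hz⟩, by simp [φ]⟩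
  let D : Decomposition (fun i => (𝒳 i).comap φ.toAddMonoidHom) :=
    comapDecomposition 𝒳 φ.toAddMonoidHom hφ fun i z => hex _ (hN i (hmem z))
  have hgr : IsRightGraded 𝒜 (fun i => (𝒳 i).comap φ.toAddMonoidHom) := by
    intro i j m r hm hr
    change φ (op r • m) ∈ 𝒳 (i + j)
    rw [map_smul]
    exact h𝒳 hm hr
  have hmap : ∀ K : Submodule Rᵐᵒᵖ P,
      K.IsHomogeneous (fun i => (𝒳 i).comap φ.toAddMonoidHom) →
      (K.map φ).IsHomogeneous 𝒳 := by
    rintro K hK i _ ⟨w, hw, rfl⟩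
    exact ⟨_, hK i hw, map_component_comap 𝒳 φ.toAddMonoidHom i w⟩
  obtain ⟨x', rfl⟩ := hex x hx
  obtain ⟨y', rfl⟩ := hex y hy
  have hPind : IsGradedIndecomposable R (fun i => (𝒳 i).comap φ.toAddMonoidHom) := by
    refine ⟨⟨x', 0, fun h => hx0 (by rw [h, map_zero])⟩, fun K L hK hL hKL => ?_⟩
    have hsup : K.map φ ⊔ L.map φ = N := by
      rw [← Submodule.map_sup, hKL.sup_eq_top, Submodule.map_top, hrange]
    have hdis : Disjoint (K.map φ) (L.map φ) := by
      rw [disjoint_iff, ← Submodule.map_inf φ hφ, hKL.inf_eq_bot, Submodule.map_bot]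
    have hbot : ∀ K : Submodule Rᵐᵒᵖ P, K.map φ = ⊥ → K = ⊥ := fun K h =>
      Submodule.map_injective_of_injective hφ (h.trans (Submodule.map_bot φ).symm)
    exact (hind _ _ (hmap K hK) (hmap L hL) hsup hdis).imp (hbot K) (hbot L)
  have hfin : Module.Finite Rᵐᵒᵖ P := Module.Finite.equiv e.symm
  have hne : ∀ (i : ℤ) (z : P), φ z ∈ 𝒳 i → φ z ≠ 0 →
      (𝒳 i).comap φ.toAddMonoidHom ≠ ⊥ := by
    intro i z hz hz0 h
    have : z ∈ (𝒳 i).comap φ.toAddMonoidHom := hz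
    rw [h, AddSubgroup.mem_bot] at this
    exact hz0 (by rw [this, map_zero])
  have h1 : (((b - a + 1).toNat : ℕ) : ℕ∞) ≤
      gradedLength (fun i => (𝒳 i).comap φ.toAddMonoidHom) := by
    unfold gradedLength
    exact le_iSup_of_le a <| le_iSup_of_le b <| le_iSup_of_le hab <|
      le_iSup_of_le (hne a x' hxa hx0) <| le_iSup_of_le (hne b y' hyb hy0) le_rfl
  have h2 : gradedLength (fun i => (𝒳 i).comap φ.toAddMonoidHom) ≤ supGradedLength 𝒜 := by
    unfold supGradedLength
    exact le_iSup_of_le P <| le_iSup_of_le _ <| le_iSup_of_le _ <| le_iSup_of_le _ <|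
      le_iSup_of_le D <| le_iSup_of_le hgr <| le_iSup_of_le hfin <| le_iSup_of_le hPind le_rfl
  have h3 := Nat.cast_le.1 ((h1.trans h2).trans hG)
  omega

/-- A finitely generated graded module splits into a part concentrated in degrees close to `d`
and a part vanishing in degree `d`. -/
lemma exists_splitting [IsArtinianRing Rᵐᵒᵖ] {G : ℕ} (hG : supGradedLength 𝒜 ≤ G)
    [Decomposition 𝒳] (h𝒳 : IsRightGraded 𝒜 𝒳) (d : ℤ) (N : Submodule Rᵐᵒᵖ X)
    (hN : N.IsHomogeneous 𝒳) (hfg : N.FG) :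
    ∃ A B : Submodule Rᵐᵒᵖ X, A.IsHomogeneous 𝒳 ∧ B.IsHomogeneous 𝒳 ∧ A ⊔ B = N ∧
      Disjoint A B ∧ (∀ i, ∀ x ∈ A, x ∈ 𝒳 i → x ≠ 0 → |i - d| ≤ G) ∧
      ∀ x ∈ B, x ∈ 𝒳 d → x = 0 := by
  -- Finitely generated modules over an artinian ring have finite length, so both summands of a
  -- nontrivial decomposition are strictly shorter.
  induction hl : Module.length Rᵐᵒᵖ N using WellFoundedLT.induction generalizing N with
  | ind l ih =>
  subst hl
  have : Module.Finite Rᵐᵒᵖ N := Module.Finite.iff_fg.2 hfg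
  have hbot : (⊥ : Submodule Rᵐᵒᵖ X).IsHomogeneous 𝒳 := by
    rintro i x hx
    rw [Submodule.mem_bot] at hx
    simp [hx]
  by_cases hind : ∀ K L : Submodule Rᵐᵒᵖ X, K.IsHomogeneous 𝒳 → L.IsHomogeneous 𝒳 → K ⊔ L = N →
      Disjoint K L → K = ⊥ ∨ L = ⊥
  · by_cases hd : ∀ x ∈ N, x ∈ 𝒳 d → x = 0
    · refine ⟨⊥, N, hbot, hN, bot_sup_eq _, disjoint_bot_left, ?_, hd⟩
      intro i x hx _ hx0
      exact absurd ((Submodule.mem_bot _).1 hx) hx0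
    · push Not at hd
      obtain ⟨y, hy, hyd, hy0⟩ := hd
      refine ⟨N, ⊥, hN, hbot, sup_bot_eq _, disjoint_bot_right, ?_,
        fun x hx _ => (Submodule.mem_bot _).1 hx⟩
      intro i x hx hxi hx0
      have h1 := sub_le_of_indecomposable hG h𝒳 hN hfg hind hx hxi hx0 hy hyd hy0
      have h2 := sub_le_of_indecomposable hG h𝒳 hN hfg hind hy hyd hy0 hx hxi hx0
      rw [abs_le]
      omega
  · push Not at hind
    obtain ⟨K, L, hK, hL, hKL, hdis, hK0, hL0⟩ := hind
    have hlen : ∀ K L : Submodule Rᵐᵒᵖ X, K ⊔ L = N → Disjoint K L → L ≠ ⊥ →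
        Module.length Rᵐᵒᵖ K < Module.length Rᵐᵒᵖ N ∧ K.FG := by
      intro K L hKL hdis hL0
      have hle : K ≤ N := hKL ▸ le_sup_left
      have hne : K.submoduleOf N ≠ ⊤ := by
        intro h
        have hNK : N ≤ K := Submodule.submoduleOf_eq_top.1 h
        exact hL0 (hdis.symm.eq_bot_of_le (le_trans (hKL ▸ le_sup_right) hNK))
      have heq : Module.length Rᵐᵒᵖ (K.submoduleOf N) = Module.length Rᵐᵒᵖ K :=
        LinearEquiv.length_eq (Submodule.submoduleOfEquivOfLe hle)
      refine ⟨heq ▸ Submodule.length_lt hne, ?_⟩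
      exact Module.Finite.iff_fg.1 (Module.Finite.equiv (Submodule.submoduleOfEquivOfLe hle))
    obtain ⟨hKl, hKfg⟩ := hlen K L hKL hdis hL0
    obtain ⟨hLl, hLfg⟩ := hlen L K (sup_comm L K ▸ hKL) hdis.symm hK0
    obtain ⟨A, B, hA, hB, rfl, hAB, hAs, hBs⟩ := ih _ hKl K hK hKfg rfl
    obtain ⟨A', B', hA', hB', rfl, hAB', hAs', hBs'⟩ := ih _ hLl L hL hLfg rfl
    have hdis4 : Disjoint (A ⊔ A') (B ⊔ B') := by
      rw [Submodule.disjoint_def] at hdis hAB hAB' ⊢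
      intro x hx hx'
      obtain ⟨p, hp, p', hp', rfl⟩ := Submodule.mem_sup.1 hx
      obtain ⟨q, hq, q', hq', h⟩ := Submodule.mem_sup.1 hx'
      -- The left side lies in `A ⊔ B`, the right side in `A' ⊔ B'`, and these are disjoint.
      have h0 : p - q = q' - p' := by rw [sub_eq_sub_iff_add_eq_add, add_comm q' q, h]
      have h1 : p - q = 0 := hdis _
        (sub_mem (Submodule.mem_sup_left hp) (Submodule.mem_sup_right hq))
        (h0 ▸ sub_mem (Submodule.mem_sup_right hq') (Submodule.mem_sup_left hp'))
      rw [h1] at h0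
      have hp0 : p = 0 := hAB p hp (sub_eq_zero.1 h1 ▸ hq)
      have hp0' : p' = 0 := hAB' p' hp' (sub_eq_zero.1 h0.symm ▸ hq')
      rw [hp0, hp0', add_zero]
    refine ⟨A ⊔ A', B ⊔ B', isHomogeneous_sup hA hA', isHomogeneous_sup hB hB', ?_, hdis4, ?_, ?_⟩
    · rw [← hKL, sup_sup_sup_comm]
    · intro i x hx hxi hx0
      obtain ⟨p, hp, p', hp', rfl⟩ := Submodule.mem_sup.1 hx
      have hsum : component 𝒳 i p + component 𝒳 i p' = p + p' := by
        rw [← map_add, component_of_mem hxi]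
      by_cases h : component 𝒳 i p = 0
      · refine hAs' i _ (hA' i hp') (component_mem 𝒳 i p') fun h' => hx0 ?_
        change component 𝒳 i p' = 0 at h'
        rw [← hsum, h, h', add_zero]
      · exact hAs i _ (hA i hp) (component_mem 𝒳 i p) h
    · intro x hx hxd
      obtain ⟨p, hp, p', hp', rfl⟩ := Submodule.mem_sup.1 hx
      rw [← component_of_mem hxd, map_add, hBs (component 𝒳 d p) (hB d hp) (component_mem 𝒳 d p),
        hBs' (component 𝒳 d p') (hB' d hp') (component_mem 𝒳 d p'), add_zero]

/-- If `G_R` is finite then `R` has only finitely many nonzero homogeneous pieces. -/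
lemma abs_degree_le [GradedRing 𝒜] [IsArtinianRing Rᵐᵒᵖ] {G : ℕ} (hG : supGradedLength 𝒜 ≤ G)
    {j : ℤ} {r : R} (hr : r ∈ 𝒜 j) (hr0 : r ≠ 0) : |j| ≤ G := by
  have hgr : IsRightGraded 𝒜 𝒜 := fun i j m r hm hr => SetLike.mul_mem_graded hm hr
  obtain ⟨A, B, hA, hB, hAB, -, hAs, hBs⟩ := exists_splitting hG hgr 0 ⊤
    (fun _ _ _ => Submodule.mem_top) ⟨{1}, by
      rw [Finset.coe_singleton, eq_top_iff]
      exact fun x _ => Submodule.mem_span_singleton.2 ⟨op x, by simp⟩⟩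
  obtain ⟨a, ha, b, hb, hab⟩ := Submodule.mem_sup.1 (hAB.symm ▸ Submodule.mem_top (x := (1 : R)))
  -- Since `1` has degree `0`, where `B` vanishes, it lies in `A`; hence `A` is all of `R`.
  have h1 : (1 : R) ∈ A := by
    rw [← component_of_mem (ℳ := 𝒜) (SetLike.GradedOne.one_mem (A := 𝒜)), ← hab, map_add,
      hBs (component 𝒜 0 b) (hB 0 hb) (component_mem 𝒜 0 b), add_zero]
    exact hA 0 ha
  have hrA : r ∈ A := by simpa using A.smul_mem (op r) h1
  simpa using hAs j r hrA hr hr0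

/-! ### Projections onto finitely generated graded summands -/

/-- A locally finite graded module has, for every degree `d`, a graded endomorphism with finitely
generated range that is the identity in degree `d`. -/
lemma exists_finite_endomorphism [GradedRing 𝒜] [IsArtinianRing Rᵐᵒᵖ] {G : ℕ}
    (hG : supGradedLength 𝒜 ≤ G) [Decomposition 𝒳] (h𝒳 : IsRightGraded 𝒜 𝒳)
    (hfin : IsLocallyFinite 𝒜 𝒳 h𝒳) (d : ℤ) :
    ∃ e : Module.End Rᵐᵒᵖ X, (∀ i, ∀ x ∈ 𝒳 i, e x ∈ 𝒳 i) ∧ (LinearMap.range e).FG ∧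
      ∀ x ∈ 𝒳 d, e x = x := by
  have hpiece : ∀ i, ∃ s : Finset X,
      Submodule.span (initialSubringOp 𝒜) (s : Set X) = homogeneousPiece 𝒜 𝒳 h𝒳 i := by
    intro i
    have h := isFiniteLength_iff_isNoetherian_isArtinian.1 (hfin i)
    have := h.1
    exact Module.Finite.iff_fg.1
      (inferInstanceAs (Module.Finite (initialSubringOp 𝒜) (homogeneousPiece 𝒜 𝒳 h𝒳 i)))
  classical
  choose s hs using hpiece
  -- Radius `2G`: the window of radius `G` containing the degrees of `A`, plus `G` for the degree of
  -- a ring element that maps into it.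
  let t : Finset X := (Finset.Icc (d - 2 * G) (d + 2 * G)).biUnion s
  let Y : Submodule Rᵐᵒᵖ X := Submodule.span Rᵐᵒᵖ (t : Set X)
  have hYhom : Y.IsHomogeneous 𝒳 := by
    refine isHomogeneous_span h𝒳 fun x hx => ?_
    obtain ⟨i, -, hi⟩ := Finset.mem_biUnion.1 (Finset.mem_coe.1 hx)
    refine ⟨i, ?_⟩
    have hx' : x ∈ homogeneousPiece 𝒜 𝒳 h𝒳 i := hs i ▸ Submodule.subset_span hi
    exact hx'
  have hYmem : ∀ i, |i - d| ≤ 2 * G → ∀ x ∈ 𝒳 i, x ∈ Y := by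
    intro i hi x hx
    have hx' : x ∈ Submodule.span (initialSubringOp 𝒜) (s i : Set X) := by
      rw [hs i]; exact hx
    have hle : Submodule.span (initialSubringOp 𝒜) (s i : Set X) ≤
        Y.restrictScalars (initialSubringOp 𝒜) := by
      refine Submodule.span_le.2 fun z hz => Submodule.subset_span ?_
      rw [abs_le] at hi
      exact Finset.mem_coe.2
        (Finset.mem_biUnion.2 ⟨i, Finset.mem_Icc.2 ⟨by omega, by omega⟩, hz⟩)
    exact hle hx'
  obtain ⟨A, B, hA, hB, hAB, hdis, hAs, hBs⟩ :=
    exists_splitting hG h𝒳 d Y hYhom ⟨t, rfl⟩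
  have hAfg : A.FG := by
    have : Module.Finite Rᵐᵒᵖ Y := Module.Finite.iff_fg.2 ⟨t, rfl⟩
    exact Module.Finite.iff_fg.1 (Module.Finite.equiv
      (Submodule.submoduleOfEquivOfLe (hAB ▸ le_sup_left : A ≤ Y)))
  have hmemB : ∀ i, ¬ |i - d| ≤ G → ∀ x ∈ 𝒳 i, x ∈ Y → x ∈ B := by
    intro i hi x hx hxY
    rw [← hAB] at hxY
    obtain ⟨a, ha, b, hb, rfl⟩ := Submodule.mem_sup.1 hxY
    have h0 : component 𝒳 i a = 0 := by
      by_contra h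
      exact hi (hAs i _ (hA i ha) (component_mem 𝒳 i a) h)
    rw [← component_of_mem hx, map_add, h0, zero_add]
    exact hB i hb
  -- The complement of `A` in `X`: equal to `B` inside the window, where `Y` is everything, and to
  -- `X` outside, where `A` vanishes.
  let T : ℤ → AddSubgroup X := fun i => if |i - d| ≤ G then B.toAddSubgroup else ⊤
  have hTB : ∀ i, |i - d| ≤ G → T i = B.toAddSubgroup := fun i hi => if_pos hi
  have hTtop : ∀ i, ¬ |i - d| ≤ G → T i = ⊤ := fun i hi => if_neg hi
  have hBT : ∀ i, B.toAddSubgroup ≤ T i := by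
    intro i
    by_cases hi : |i - d| ≤ G
    · rw [hTB i hi]
    · rw [hTtop i hi]; exact le_top
  have hT : ∀ ⦃i j : ℤ⦄ ⦃m : X⦄ ⦃r : R⦄, m ∈ 𝒳 i → m ∈ T i → r ∈ 𝒜 j →
      op r • m ∈ T (i + j) := by
    intro i j m r hm hmT hr
    by_cases hij : |i + j - d| ≤ G
    · by_cases hr0 : r = 0
      · rw [hr0, op_zero, zero_smul]; exact zero_mem _
      refine hBT _ (B.smul_mem (op r) ?_)
      by_cases hi : |i - d| ≤ G
      · rw [hTB i hi] at hmT; exact hmT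
      -- A product entering the window from outside starts within `2G` of `d`, so in `Y`; outside
      -- the window `Y` agrees with `B`.
      · have hj := abs_degree_le hG hr hr0
        refine hmemB i hi m hm (hYmem i ?_ m hm)
        rw [abs_le] at hij hj ⊢
        omega
    · rw [hTtop _ hij]; trivial
  let C := ofComponents h𝒳 T hT
  have hChom : C.IsHomogeneous 𝒳 := isHomogeneous_ofComponents h𝒳 T hT
  have hBC : B ≤ C := fun x hx i => hBT i (hB i hx)
  have hcompl : IsCompl A C := by
    constructor
    · rw [Submodule.disjoint_def] at hdis ⊢
      intro x hxA hxC
      refine eq_zero_of_component_eq_zero 𝒳 fun i => ?_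
      by_contra h
      have hi := hAs i _ (hA i hxA) (component_mem 𝒳 i x) h
      have hxB : component 𝒳 i x ∈ T i := hxC i
      rw [hTB i hi] at hxB
      exact h (hdis _ (hA i hxA) hxB)
    · rw [codisjoint_iff, eq_top_iff]
      intro x _
      refine mem_of_component_mem 𝒳 (S := (A ⊔ C).toAddSubgroup) fun i => ?_
      by_cases hi : |i - d| ≤ G
      · have : component 𝒳 i x ∈ A ⊔ B := by
          rw [hAB]
          exact hYmem i (by omega) _ (component_mem 𝒳 i x)
        exact sup_le_sup_left hBC A this
      · refine Submodule.mem_sup_right (mem_ofComponents_of_mem (component_mem 𝒳 i x) ?_)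
        rw [hTtop i hi]; trivial
  refine ⟨Submodule.projection A C hcompl, ?_, ?_, ?_⟩
  · intro i x hx
    obtain ⟨a, ha, c, hc, rfl⟩ := Submodule.mem_sup.1
      (hcompl.sup_eq_top.symm ▸ Submodule.mem_top (x := x))
    have hpa : ∀ a ∈ A, ∀ c ∈ C, Submodule.projection A C hcompl (a + c) = a := by
      intro a ha c hc
      rw [map_add, (Submodule.projection_eq_self_iff hcompl a).2 ha,
        (Submodule.projection_apply_eq_zero_iff hcompl).2 hc, add_zero]
    have h := hpa _ (hA i ha) _ (hChom i hc)
    change Submodule.projection A C hcompl (component 𝒳 i a + component 𝒳 i c) =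
      component 𝒳 i a at h
    rw [← map_add, component_of_mem hx] at h
    rw [h]
    exact component_mem 𝒳 i a
  · rwa [Submodule.range_projection]
  · intro x hx
    refine (Submodule.projection_eq_self_iff hcompl x).2 ?_
    have hxY : x ∈ A ⊔ B := by
      rw [hAB]
      exact hYmem d (by simp) x hx
    obtain ⟨a, ha, b, hb, rfl⟩ := Submodule.mem_sup.1 hxY
    rw [← component_of_mem hx, map_add, hBs (component 𝒳 d b) (hB d hb) (component_mem 𝒳 d b),
      add_zero]
    exact hA d ha

/-! ### Pure-projectivity from pointwise finite sums -/

/-- A module over a noetherian ring is pure-projective if its identity is a pointwise finite sum of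
endomorphisms with finitely generated range. -/
lemma isPureProjective_of_sum_eq {S : Type u} [Ring S] [IsNoetherianRing S] {M : Type v}
    [AddCommGroup M] [Module S M] (f : ℕ → Module.End S M) (hf : ∀ n, (LinearMap.range (f n)).FG)
    (hsum : ∀ x, ∃ N, (∀ n, N ≤ n → f n x = 0) ∧ ∑ n ∈ Finset.range N, f n x = x) :
    IsPureProjective S M := by
  classical
  have hfin : ∀ n, Module.Finite S (LinearMap.range (f n)) := fun n => Module.Finite.iff_fg.2 (hf n)
  choose P hP hP' e using fun n => exists_linearEquiv_of_finite S (LinearMap.range (f n))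
  replace e := fun n => (e n).some
  let ι : Type (max u v) := ULift ℕ
  let p : ∀ i : ι, M →ₗ[S] P i.down := fun i =>
    (e i.down).symm.toLinearMap ∘ₗ (f i.down).rangeRestrict
  let q : ∀ i : ι, P i.down →ₗ[S] M := fun i => Submodule.subtype _ ∘ₗ (e i.down).toLinearMap
  have hqp : ∀ i x, q i (p i x) = f i.down x := by
    intro i x
    simp [p, q]
  have hp0 : ∀ i x, f i.down x = 0 → p i x = 0 := by
    intro i x h
    have : (f i.down).rangeRestrict x = 0 := Subtype.ext h
    simp [p, this]
  -- The finite sum `F x N` has a bound `N` depending on `x`, so it is not visibly linear in `x`.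
  -- The splitting map is instead `LinearMap.pi p`, factored through the embedding `c` of the direct
  -- sum in the product.
  let c : DirectSum ι (fun i => P i.down) →ₗ[S] ∀ i : ι, P i.down :=
    DFinsupp.coeFnLinearMap S
  have hc : Function.Injective c := DFunLike.coe_injective
  let F : M → ℕ → DirectSum ι (fun i => P i.down) := fun x N =>
    ∑ n ∈ Finset.range N, DirectSum.lof S ι (fun i => P i.down) ⟨n⟩ (p ⟨n⟩ x)
  have hF : ∀ x N, (∀ n, N ≤ n → f n x = 0) → c (F x N) = LinearMap.pi p x := by
    intro x N hN
    ext i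
    have hterm : ∀ n, c (DirectSum.lof S ι (fun i => P i.down) ⟨n⟩ (p ⟨n⟩ x)) i =
        if n = i.down then p i x else 0 := by
      intro n
      by_cases h : n = i.down
      · subst h
        rw [if_pos rfl]
        exact DirectSum.lof_apply (M := fun i : ι => P i.down) S i (p i x)
      · rw [if_neg h]
        exact DirectSum.of_eq_of_ne _ _ _ (fun h' => h (congrArg ULift.down h').symm)
    simp only [F, map_sum, Finset.sum_apply, hterm, Finset.sum_ite_eq', Finset.mem_range,
      LinearMap.pi_apply]
    split_ifs with h
    · rfl
    · exact (hp0 i x (hN _ (not_lt.1 h))).symm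
  have hmem : ∀ x, LinearMap.pi p x ∈ LinearMap.range c := by
    intro x
    obtain ⟨N, hN, -⟩ := hsum x
    exact ⟨F x N, hF x N hN⟩
  let g : M →ₗ[S] DirectSum ι (fun i => P i.down) :=
    (LinearEquiv.ofInjective c hc).symm.toLinearMap ∘ₗ (LinearMap.pi p).codRestrict _ hmem
  have hg : ∀ x, c (g x) = LinearMap.pi p x := by
    intro x
    have := (LinearEquiv.ofInjective c hc).apply_symm_apply ((LinearMap.pi p).codRestrict _ hmem x)
    exact congrArg Subtype.val this
  refine ⟨ι, fun i => P i.down, fun i => hP i.down, fun i => hP' i.down, fun i => ?_, g,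
    DirectSum.toModule S ι M q, ?_⟩
  · have : Module.Finite S (P i.down) := Module.Finite.equiv (e i.down).symm
    exact Module.finitePresentation_of_finite S _
  · ext x
    obtain ⟨N, hN, hs⟩ := hsum x
    have hgF : g x = F x N := hc ((hg x).trans (hF x N hN).symm)
    rw [LinearMap.comp_apply, hgF]
    simp only [F, map_sum, DirectSum.toModule_lof, hqp, hs, LinearMap.id_apply]

/-- A graded module that has graded endomorphisms with finitely generated range which are the
identity in any prescribed degree is pure-projective. -/
lemma isPureProjective_of_endomorphisms {S : Type u} [Ring S] [IsNoetherianRing S] {M : Type v}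
    [AddCommGroup M] [Module S M] (ℳ : ℤ → AddSubgroup M) [Decomposition ℳ]
    (h : ∀ d, ∃ e : Module.End S M, (∀ i, ∀ x ∈ ℳ i, e x ∈ ℳ i) ∧ (LinearMap.range e).FG ∧
      ∀ x ∈ ℳ d, e x = x) : IsPureProjective S M := by
  choose e hgr hfg hid using h
  let δ : ℕ ≃ ℤ := Equiv.intEquivNat.symm
  -- `c n` is what remains of the identity after the first `n` degrees have been dealt with.
  let c : ℕ → Module.End S M := fun n => Nat.rec 1 (fun n c => (1 - e (δ n)) * c) n
  have hc : ∀ n x, c (n + 1) x = c n x - e (δ n) (c n x) := fun n x => rfl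
  have hcgr : ∀ n i, ∀ x ∈ ℳ i, c n x ∈ ℳ i := by
    intro n i x hx
    induction n with
    | zero => exact hx
    | succ n ih => rw [hc]; exact sub_mem ih (hgr _ _ _ ih)
  have hstep : ∀ n x, c n x = 0 → c (n + 1) x = 0 := by
    intro n x h
    rw [hc, h, map_zero, sub_zero]
  have hczero : ∀ x, ∃ N, ∀ n, N ≤ n → c n x = 0 := by
    intro x
    obtain ⟨s, hs⟩ := exists_sum_component_eq ℳ x
    -- The factor `1 - e i` first occurs in `c (δ.symm i + 1)`. The earlier factors preserve degree
    -- `i`, so this one still kills the component of degree `i`.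
    refine ⟨s.sup fun i => δ.symm i + 1, fun n hn => ?_⟩
    rw [← hs, map_sum]
    refine Finset.sum_eq_zero fun i hi => ?_
    have hin : δ.symm i + 1 ≤ n := (Finset.le_sup (f := fun i => δ.symm i + 1) hi).trans hn
    clear hn
    induction n, hin using Nat.le_induction with
    | base =>
      have hm := hcgr (δ.symm i) i _ (component_mem ℳ i x)
      rw [hc, Equiv.apply_symm_apply, hid i _ hm, sub_self]
    | succ n _ ih => exact hstep _ _ ih
  refine isPureProjective_of_sum_eq (fun n => e (δ n) * c n) (fun n => ?_) fun x => ?_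
  · have : Module.Finite S (LinearMap.range (e (δ n))) := Module.Finite.iff_fg.2 (hfg _)
    have hle : LinearMap.range (e (δ n) * c n) ≤ LinearMap.range (e (δ n)) :=
      LinearMap.range_comp_le_range _ _
    exact Module.Finite.iff_fg.1 (Module.Finite.equiv (Submodule.submoduleOfEquivOfLe hle))
  · obtain ⟨N, hN⟩ := hczero x
    refine ⟨N, fun n hn => ?_, ?_⟩
    · rw [Module.End.mul_apply, hN n hn, map_zero]
    -- The sum telescopes to `c 0 x - c N x = x`.
    · have : ∀ n, (e (δ n) * c n) x = c n x - c (n + 1) x := by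
        intro n
        rw [hc, sub_sub_cancel, Module.End.mul_apply]
      simp only [this, Finset.sum_range_sub', hN N le_rfl, sub_zero]
      rfl

end GradedArtinian

theorem mainTheorem3 {R : Type u} [Ring R] (𝒜 : ℤ → AddSubgroup R) [GradedRing 𝒜]
    [IsArtinianRing Rᵐᵒᵖ] (hG : GradedArtinian.supGradedLength 𝒜 < ⊤)
    {X : Type v} [AddCommGroup X] [Module Rᵐᵒᵖ X] (𝒳 : ℤ → AddSubgroup X)
    [DirectSum.Decomposition 𝒳] (h𝒳 : GradedArtinian.IsRightGraded 𝒜 𝒳)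
    (hfin : GradedArtinian.IsLocallyFinite 𝒜 𝒳 h𝒳) :
    GradedArtinian.IsPureProjective Rᵐᵒᵖ X := by
  obtain ⟨G, hG'⟩ := ENat.ne_top_iff_exists.1 hG.ne
  exact GradedArtinian.isPureProjective_of_endomorphisms 𝒳
    (GradedArtinian.exists_finite_endomorphism hG'.ge h𝒳 hfin)
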